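/- For $a,b,z\in\mathbb C$ with $b\notin\{0,-1,-2,\dots\}$ let ${}_1F_1(a;b;z)=\sum_{n\ge 0}\frac{(a)_n}{(b)_n}\frac{z^n}{n!}$, where $(a)_0=1$ and $(a)_n=a(a+1)\cdots(a+n-1)$. For $\tau\in\mathbb C$ let $H_\tau$ be the Hermite function of degree $\tau$, $$H_\tau(z)=2^\tau\frac{\Gamma(\frac12)}{\Gamma(\frac{1-\tau}{2})}\,{}_1F_1\!\left(-\tfrac{\tau}{2};\tfrac12;z^2\right)+2^\tau z\,\frac{\Gamma(-\frac12)}{\Gamma(-\frac{\tau}{2})}\,{}_1F_1\!\left(\tfrac{1-\tau}{2};\tfrac32;z^2\right),\qquad z\in\mathbb C,$$ where $1/\Gamma$ denotes the entire function, equal to $0$ at $0,-1,-2,\dots$. Let $\mathscr G_H(\tau)$ be the generalized Hermite linear functional of index $\tau$, i.e. the linear functional on $\mathbb C[x]$ with moments $$\langle\mathscr G_H(\tau),x^{2k}\rangle=\frac{(\tau+1)_{2k}}{k!\,2^{2k}},\qquad \langle\mathscr G_H(\tau),x^{2k+1}\rangle=0,\qquad k=0,1,2,\dots$$ **Theorem.**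 Let $\tau\in\mathbb C$ with $\operatorname{Re}(\tau)>-1$. Then for every polynomial $p\in\mathbb C[x]$ the function $x\mapsto p(x)|x|^\tau H_\tau(|x|)e^{-x^2}$ is (absolutely) integrable on $\mathbb R$, and $$\langle\mathscr G_H(\tau),p\rangle=\frac{1}{\sqrt{\pi}\,\Gamma(\tau+1)}\int_{-\infty}^{\infty}p(x)\,|x|^\tau H_\tau(|x|)\,e^{-x^2}\,dx .$$ -/

import Mathlib

open MeasureTheory

/-- Kummer's confluent hypergeometric function `₁F₁(a; b; z) = ∑ (a)ₙ / (b)ₙ * zⁿ / n!`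
(meant for `b ∉ {0, -1, -2, …}`; the series then converges for every complex `z`). -/
noncomputable def confluentHypergeometric (a b z : ℂ) : ℂ :=
  ∑' n : ℕ, (ascPochhammer ℂ n).eval a / (ascPochhammer ℂ n).eval b * (z ^ n / (n.factorial : ℂ))

/-- The Hermite function of complex degree `τ`. At the poles of the denominators,
`Complex.Gamma` is `0` and so is the quotient, which is the value of the entire function `1 / Γ`
there. -/
noncomputable def hermiteFunction (τ z : ℂ) : ℂ :=
  (2 : ℂ) ^ τ * (Complex.Gamma (1 / 2) / Complex.Gamma ((1 - τ) / 2)) *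
      confluentHypergeometric (-τ / 2) (1 / 2) (z ^ 2) +
    (2 : ℂ) ^ τ * z * (Complex.Gamma (-1 / 2) / Complex.Gamma (-τ / 2)) *
      confluentHypergeometric ((1 - τ) / 2) (3 / 2) (z ^ 2)

/-- The moments of the generalized Hermite functional of index `τ`:
`(τ + 1)₂ₖ / (k! 2²ᵏ)` for `n = 2 k`, and `0` for odd `n`. -/
noncomputable def generalizedHermiteMoment (τ : ℂ) (n : ℕ) : ℂ :=
  if Even n then
    (ascPochhammer ℂ n).eval (τ + 1) / (((n / 2).factorial : ℂ) * (2 : ℂ) ^ n)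
  else 0

/-- The generalized Hermite linear functional of index `τ`: the linear functional on complex
polynomials that takes the value `generalizedHermiteMoment τ n` at `Xⁿ` for every `n`. -/
noncomputable def generalizedHermiteFunctional (τ : ℂ) : Module.Dual ℂ (Polynomial ℂ) :=
  (Polynomial.basisMonomials ℂ).constr ℂ (generalizedHermiteMoment τ)

theorem generalizedHermiteFunctional_X_pow (τ : ℂ) (n : ℕ) :
    generalizedHermiteFunctional τ (Polynomial.X ^ n) = generalizedHermiteMoment τ n := by
  have h := (Polynomial.basisMonomials ℂ).constr_basis ℂ (generalizedHermiteMoment τ) n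
  simp only [Polynomial.coe_basisMonomials, Polynomial.monomial_one_right_eq_X_pow] at h
  exact h

theorem generalizedHermiteMoment_even (τ : ℂ) (k : ℕ) :
    generalizedHermiteMoment τ (2 * k) =
      (ascPochhammer ℂ (2 * k)).eval (τ + 1) / ((k.factorial : ℂ) * (2 : ℂ) ^ (2 * k)) := by
  simp [generalizedHermiteMoment]

theorem generalizedHermiteMoment_odd (τ : ℂ) (k : ℕ) :
    generalizedHermiteMoment τ (2 * k + 1) = 0 := by
  simp [generalizedHermiteMoment]

/-! Everything reduces to one Mellin transform, `hasMellin_hermiteFunction`: for every `τ` and `Re s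
> 0`, the transform of `e^{-x²} H_τ(x)` is `√π 2^{τ-s} Γ(s) / Γ((s-τ+1)/2)`. At `s = τ + n + 1`,
where `Re τ > -1` gives `Re s > 0`, this is the half-line integral of the `n`-th moment; for `n =
2k` the denominator becomes `Γ(k+1) = k!`. Parity then doubles the even moments and kills the odd
ones.

For `Re τ < 0` one has `Γ(-τ) H_τ(x) = ∫₀^∞ t^{-τ-1} e^{-t²-2tx} dt`
(`Gamma_neg_mul_hermiteFunction`). Multiplying by `e^{-x²}` completes the square to `e^{-(t+x)²}`,
and with `u = t + x` the double integral factors into a Beta integral and a Gaussian Mellin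
transform. Legendre duplication gives the closed form.

The recurrence `H_{τ+1} = 2z H_τ - 2τ H_{τ-1}` carries both convergence and formula to all `τ`, with
no analytic continuation. -/

/-! ### Kummer's function: convergence and contiguous relations -/

theorem ascPochhammer_eval_ne_zero {b : ℂ} (hb : ∀ n : ℕ, b + n ≠ 0) (n : ℕ) :
    (ascPochhammer ℂ n).eval b ≠ 0 := by
  induction n with
  | zero => simp
  | succ n ih => rw [ascPochhammer_succ_eval]; exact mul_ne_zero ih (hb n)

theorem ascPochhammer_eval_add_one_mul (a : ℂ) (n : ℕ) :
    a * (ascPochhammer ℂ n).eval (a + 1) = (ascPochhammer ℂ n).eval a * (a + n) := by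
  rw [← ascPochhammer_succ_eval, ascPochhammer_succ_left]
  simp

theorem summable_confluentHypergeometric (a : ℂ) {b : ℂ} (hb : ∀ n : ℕ, b + n ≠ 0) (z : ℂ) :
    Summable fun n : ℕ => (ascPochhammer ℂ n).eval a / (ascPochhammer ℂ n).eval b *
      (z ^ n / (n.factorial : ℂ)) := by
  have hlim : Filter.Tendsto (fun n : ℕ => (a + n) / (b + n) * (z / (n + 1)))
      Filter.atTop (nhds 0) := by
    have h0 := tendsto_inv_atTop_nhds_zero_nat (𝕜 := ℂ)
    have h1 : Filter.Tendsto (fun n : ℕ => (a * (n : ℂ)⁻¹ + 1) / (b * (n : ℂ)⁻¹ + 1))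
        Filter.atTop (nhds ((a * 0 + 1) / (b * 0 + 1))) :=
      ((h0.const_mul a).add_const 1).div ((h0.const_mul b).add_const 1) (by simp)
    have h2 : Filter.Tendsto (fun n : ℕ => z * (1 / ((n : ℂ) + 1))) Filter.atTop
        (nhds (z * 0)) := (tendsto_one_div_add_atTop_nhds_zero_nat (𝕜 := ℂ)).const_mul z
    have h3 := h1.mul h2
    simp only [mul_zero] at h3
    refine h3.congr' ?_
    filter_upwards [Filter.eventually_gt_atTop 0] with n hn
    have hn' : (n : ℂ) ≠ 0 := by exact_mod_cast hn.ne'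
    have hbn := hb n
    have hbn' : b * (n : ℂ)⁻¹ + 1 ≠ 0 := by
      have : b * (n : ℂ)⁻¹ + 1 = (b + n) * (n : ℂ)⁻¹ := by field_simp
      rw [this]; exact mul_ne_zero hbn (inv_ne_zero hn')
    rw [mul_one_div]
    congr 1
    rw [div_eq_div_iff hbn' hbn]
    field_simp
  have hev := (hlim.norm).eventually_le_const (u := 1 / 2) (by norm_num)
  refine summable_of_ratio_norm_eventually_le (r := 1 / 2) (by norm_num) ?_
  filter_upwards [hev] with n hn
  have key : (ascPochhammer ℂ (n + 1)).eval a / (ascPochhammer ℂ (n + 1)).eval b *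
      (z ^ (n + 1) / ((n + 1).factorial : ℂ)) = ((a + n) / (b + n) * (z / (n + 1))) *
      ((ascPochhammer ℂ n).eval a / (ascPochhammer ℂ n).eval b *
      (z ^ n / (n.factorial : ℂ))) := by
    rw [ascPochhammer_succ_eval, ascPochhammer_succ_eval, Nat.factorial_succ]
    push_cast
    rw [pow_succ]
    simp only [div_eq_mul_inv, mul_inv]
    ring
  rw [key, norm_mul]
  gcongr

/-- Since `(a+1)ₙ - (a)ₙ = n (a+1)ₙ₋₁`, the constant term cancels and the index shifts by one. -/
theorem confluentHypergeometric_sub_eq (a : ℂ) {b : ℂ} (hb : ∀ n : ℕ, b + n ≠ 0) (z : ℂ) :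
    confluentHypergeometric (a + 1) b z - confluentHypergeometric a b z =
      z / b * confluentHypergeometric (a + 1) (b + 1) z := by
  have hb0 : b ≠ 0 := by simpa using hb 0
  have hb' : ∀ n : ℕ, b + 1 + n ≠ 0 := fun n => by
    have := hb (n + 1); push_cast at this; rwa [add_right_comm, ← add_assoc] at *
  have hs1 := summable_confluentHypergeometric (a + 1) hb z
  have hs2 := summable_confluentHypergeometric a hb z
  unfold confluentHypergeometric
  rw [← hs1.tsum_sub hs2, (hs1.sub hs2).tsum_eq_zero_add, ← tsum_mul_left]
  simp only [ascPochhammer_zero, Polynomial.eval_one, sub_self, zero_add]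
  refine tsum_congr fun n => ?_
  have h1 := ascPochhammer_eval_add_one_mul b n
  have h2 := ascPochhammer_eval_ne_zero hb n
  have h3 := ascPochhammer_eval_ne_zero hb' n
  have h4 : (ascPochhammer ℂ (n + 1)).eval a = a * (ascPochhammer ℂ n).eval (a + 1) := by
    rw [ascPochhammer_succ_left]; simp
  have h5 : (ascPochhammer ℂ (n + 1)).eval b = b * (ascPochhammer ℂ n).eval (b + 1) := by
    rw [ascPochhammer_succ_left]; simp
  rw [h4, h5, ascPochhammer_succ_eval, Nat.factorial_succ]
  have hn : (n : ℂ) + 1 ≠ 0 := by exact_mod_cast n.succ_ne_zero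
  have hf : (n.factorial : ℂ) ≠ 0 := by exact_mod_cast n.factorial_ne_zero
  push_cast
  field_simp
  ring

/-- Termwise, from `a (a+1)ₙ = (a)ₙ (a+n)` and the same identity for `b`. -/
theorem confluentHypergeometric_contiguous (a : ℂ) {b : ℂ} (hb : ∀ n : ℕ, b + n ≠ 0) (z : ℂ) :
    a * confluentHypergeometric (a + 1) (b + 1) z - (a - b) * confluentHypergeometric a (b + 1) z
      = b * confluentHypergeometric a b z := by
  have hb' : ∀ n : ℕ, b + 1 + n ≠ 0 := fun n => by
    have := hb (n + 1); push_cast at this; rwa [add_right_comm, ← add_assoc] at *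
  have hs1 := summable_confluentHypergeometric (a + 1) hb' z
  have hs2 := summable_confluentHypergeometric a hb' z
  unfold confluentHypergeometric
  rw [← tsum_mul_left, ← tsum_mul_left, ← tsum_mul_left,
    ← (hs1.mul_left a).tsum_sub (hs2.mul_left (a - b))]
  refine tsum_congr fun n => ?_
  have h1 := ascPochhammer_eval_add_one_mul b n
  have h2 := ascPochhammer_eval_ne_zero hb n
  have h3 := ascPochhammer_eval_ne_zero hb' n
  have h4 := ascPochhammer_eval_add_one_mul a n
  have e : b / (ascPochhammer ℂ n).eval b = (b + n) / (ascPochhammer ℂ n).eval (b + 1) := by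
    rw [div_eq_div_iff h2 h3, h1]; ring
  calc _ = (a * (ascPochhammer ℂ n).eval (a + 1) - (a - b) * (ascPochhammer ℂ n).eval a) /
        (ascPochhammer ℂ n).eval (b + 1) * (z ^ n / (n.factorial : ℂ)) := by ring
    _ = (b + n) / (ascPochhammer ℂ n).eval (b + 1) * (ascPochhammer ℂ n).eval a *
        (z ^ n / (n.factorial : ℂ)) := by rw [h4]; ring
    _ = _ := by rw [← e]; ring

/-! ### Recurrence in the degree -/

theorem one_half_add_nat_ne_zero (n : ℕ) : (1 / 2 : ℂ) + n ≠ 0 := by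
  intro h
  have := congrArg Complex.re h
  simp at this
  have : (0 : ℝ) ≤ n := n.cast_nonneg
  linarith

theorem Complex.Gamma_neg_one_half : Complex.Gamma (-1 / 2) = -2 * Complex.Gamma (1 / 2) := by
  have := Complex.Gamma_add_one (-1 / 2) (by norm_num)
  rw [show (-1 / 2 + 1 : ℂ) = 1 / 2 by norm_num] at this
  rw [this]; ring

theorem hermiteFunction_eq (τ z : ℂ) : hermiteFunction τ z =
    2 ^ τ * Complex.Gamma (1 / 2) *
      ((Complex.Gamma ((1 - τ) / 2))⁻¹ * confluentHypergeometric (-τ / 2) (1 / 2) (z ^ 2) -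
      2 * z * (Complex.Gamma (-τ / 2))⁻¹ *
        confluentHypergeometric ((1 - τ) / 2) (3 / 2) (z ^ 2)) := by
  rw [hermiteFunction, Complex.Gamma_neg_one_half]
  ring

/-- The even part in `z` is the first contiguous relation, the odd part the second. The factors are
matched by `1/Γ(w) = w/Γ(w+1)`, which survives at the poles of `Γ`, so no `τ` is exceptional. -/
theorem hermiteFunction_add_one (τ z : ℂ) :
    hermiteFunction (τ + 1) z = 2 * z * hermiteFunction τ z - 2 * τ * hermiteFunction (τ - 1) z := by
  have hE := confluentHypergeometric_sub_eq ((-τ - 1) / 2) one_half_add_nat_ne_zero (z ^ 2)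
  have hO := confluentHypergeometric_contiguous (-τ / 2) one_half_add_nat_ne_zero (z ^ 2)
  have g1 := Complex.one_div_Gamma_eq_self_mul_one_div_Gamma_add_one (-τ / 2)
  have g2 := Complex.one_div_Gamma_eq_self_mul_one_div_Gamma_add_one ((-τ - 1) / 2)
  rw [show (1 / 2 + 1 : ℂ) = 3 / 2 by norm_num] at hE hO
  rw [show (-τ - 1) / 2 + 1 = (1 - τ) / 2 by ring] at hE g2
  rw [show -τ / 2 + 1 = (2 - τ) / 2 by ring] at hO g1
  rw [hermiteFunction_eq, hermiteFunction_eq, hermiteFunction_eq,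
    show (1 - (τ + 1)) / 2 = -τ / 2 by ring, show -(τ + 1) / 2 = (-τ - 1) / 2 by ring,
    show (1 - (τ - 1)) / 2 = (2 - τ) / 2 by ring, show -(τ - 1) / 2 = (1 - τ) / 2 by ring,
    Complex.cpow_add _ _ two_ne_zero, Complex.cpow_sub _ _ two_ne_zero, Complex.cpow_one, g2]
  set A := (Complex.Gamma ((1 - τ) / 2))⁻¹
  set B := (Complex.Gamma (-τ / 2))⁻¹
  set C := (Complex.Gamma ((2 - τ) / 2))⁻¹
  linear_combination (2 : ℂ) ^ τ * Complex.Gamma (1 / 2) * (-(2 * B) * hE +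
    2 * z * A * 2 * hO + 2 * confluentHypergeometric ((1 - τ) / 2) (1 / 2) (z ^ 2) * g1)

/-! ### Integral representation for `Re τ < 0` -/

theorem hasMellin_exp_neg_sq {s : ℂ} (hs : 0 < s.re) :
    HasMellin (fun t : ℝ => Complex.exp (-(t : ℂ) ^ 2)) s (Complex.Gamma (s / 2) / 2) := by
  have hs2 : 0 < (s / 2).re := by simpa using hs
  have e : (fun t : ℝ => Complex.exp (-(t : ℂ) ^ 2)) =
      fun t : ℝ => (fun u : ℝ => (Real.exp (-u) : ℂ)) (t ^ (2 : ℝ)) := by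
    funext t; simp
  rw [e]
  have hG := Complex.GammaIntegral_convergent hs2
  refine ⟨(MellinConvergent.comp_rpow (f := fun u : ℝ => (Real.exp (-u) : ℂ)) two_ne_zero).2 ?_,
    (mellin_comp_rpow (fun u : ℝ => (Real.exp (-u) : ℂ)) s 2).trans ?_⟩
  · simpa [MellinConvergent, mul_comm] using hG
  · rw [← Complex.GammaIntegral_eq_mellin, Complex.ofReal_ofNat, ← Complex.Gamma_eq_integral hs2,
      Complex.real_smul]
    norm_num
    ring

theorem integrableOn_rpow_mul_exp_neg_sq_add_mul {c : ℝ} (hc : 0 < c) (a : ℝ) :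
    IntegrableOn (fun t : ℝ => t ^ (c - 1) * Real.exp (-t ^ 2 + a * t)) (Set.Ioi 0) := by
  -- Half of the Gaussian absorbs the linear term: `a t ≤ t²/2 + a²/2`.
  have h := (integrableOn_rpow_mul_exp_neg_mul_sq (b := 1 / 2) (by norm_num)
    (s := c - 1) (by linarith)).const_mul (Real.exp (a ^ 2 / 2))
  refine h.mono' (by fun_prop) ?_
  filter_upwards [ae_restrict_mem measurableSet_Ioi] with t ht
  have ht : 0 < t := ht
  rw [Real.norm_of_nonneg (by positivity), mul_left_comm, ← Real.exp_add]
  refine mul_le_mul_of_nonneg_left (Real.exp_le_exp.2 ?_) (by positivity)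
  nlinarith [sq_nonneg (t - a)]

/-- Expand `e^{at}` and integrate termwise; the norms of the terms sum to the same integrand with
`|a|` and `Re c`, which is integrable. -/
theorem hasSum_integral_cpow_mul_exp_neg_sq_add_mul {c : ℂ} (hc : 0 < c.re) (a : ℝ) :
    HasSum (fun n : ℕ => (a : ℂ) ^ n / (n.factorial : ℂ) * (Complex.Gamma ((c + n) / 2) / 2))
      (∫ t : ℝ in Set.Ioi 0, (t : ℂ) ^ (c - 1) * Complex.exp (-(t : ℂ) ^ 2 + a * t)) := by
  have hF : ∀ n : ℕ, ∫ t : ℝ in Set.Ioi 0, (a : ℂ) ^ n / (n.factorial : ℂ) *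
      ((t : ℂ) ^ (c + n - 1) • Complex.exp (-(t : ℂ) ^ 2)) =
      (a : ℂ) ^ n / (n.factorial : ℂ) * (Complex.Gamma ((c + n) / 2) / 2) := fun n => by
    rw [integral_const_mul]
    congr 1
    exact (hasMellin_exp_neg_sq (s := c + n) (by simp; positivity)).2
  simp_rw [← hF]
  have hsum : ∀ t : ℝ, HasSum (fun n : ℕ => t ^ (c.re - 1) * Real.exp (-t ^ 2) *
      ((|a| * t) ^ n / (n.factorial : ℝ)))
      (t ^ (c.re - 1) * Real.exp (-t ^ 2 + |a| * t)) := fun t => by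
    rw [Real.exp_add, ← mul_assoc, Real.exp_eq_exp_ℝ]
    exact (NormedSpace.expSeries_div_hasSum_exp (|a| * t)).mul_left _
  refine hasSum_integral_of_dominated_convergence
    (fun n t => t ^ (c.re - 1) * Real.exp (-t ^ 2) * ((|a| * t) ^ n / (n.factorial : ℝ)))
    (fun n => by fun_prop) (fun n => ?_) (.of_forall fun t => (hsum t).summable) ?_ ?_
  · filter_upwards [ae_restrict_mem measurableSet_Ioi] with t ht
    have ht : 0 < t := ht
    have h1 : ‖(t : ℂ) ^ (c + n - 1)‖ = t ^ (c.re - 1) * t ^ n := by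
      rw [Complex.norm_cpow_eq_rpow_re_of_pos ht, ← Real.rpow_natCast t n, ← Real.rpow_add ht]
      congr 1
      simp
      ring
    have h2 : ‖Complex.exp (-(t : ℂ) ^ 2)‖ = Real.exp (-t ^ 2) := by
      rw [Complex.norm_exp]
      norm_cast
    rw [norm_mul, norm_smul, h1, h2, norm_div, norm_pow, Complex.norm_real, Complex.norm_natCast,
      Real.norm_eq_abs, mul_pow]
    apply le_of_eq
    ring
  · simp_rw [fun t => (hsum t).tsum_eq]
    exact integrableOn_rpow_mul_exp_neg_sq_add_mul hc |a|
  · filter_upwards [ae_restrict_mem measurableSet_Ioi] with t ht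
    have ht : 0 < t := ht
    have h := (NormedSpace.expSeries_div_hasSum_exp ((a : ℂ) * t)).mul_left
      ((t : ℂ) ^ (c - 1) * Complex.exp (-(t : ℂ) ^ 2))
    rw [← Complex.exp_eq_exp_ℂ, mul_assoc, ← Complex.exp_add] at h
    refine h.congr_fun fun n => ?_
    rw [add_sub_right_comm, Complex.cpow_add _ _ (by exact_mod_cast ht.ne'), Complex.cpow_natCast,
      mul_pow, smul_eq_mul]
    ring

theorem cast_factorial_two_mul (n : ℕ) :
    ((2 * n).factorial : ℂ) = 4 ^ n * n.factorial * (ascPochhammer ℂ n).eval (1 / 2) := by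
  induction n with
  | zero => simp
  | succ n ih =>
    rw [ascPochhammer_succ_eval, Nat.mul_succ, Nat.factorial_succ, Nat.factorial_succ,
      Nat.factorial_succ]
    push_cast
    rw [ih]
    ring

theorem cast_factorial_two_mul_add_one (n : ℕ) :
    ((2 * n + 1).factorial : ℂ) = 4 ^ n * n.factorial * (ascPochhammer ℂ n).eval (3 / 2) := by
  have := ascPochhammer_eval_add_one_mul (1 / 2) n
  rw [Nat.factorial_succ]
  push_cast
  rw [cast_factorial_two_mul]
  rw [show (1 / 2 + 1 : ℂ) = 3 / 2 by norm_num] at this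
  linear_combination -2 * (4 ^ n * (n.factorial : ℂ)) * this

theorem Complex.Gamma_add_natCast_of_re_pos {w : ℂ} (hw : 0 < w.re) (n : ℕ) :
    Complex.Gamma (w + n) = Complex.Gamma w * (ascPochhammer ℂ n).eval w := by
  rw [← Complex.Gamma_add_nat_div_Gamma_eq w, mul_div_cancel₀ _ (Complex.Gamma_ne_zero_of_re_pos hw)]
  intro k hk
  rw [hk] at hw
  simp at hw
  exact absurd hw (not_lt.2 k.cast_nonneg)

theorem tsum_pow_two_mul_div_factorial_mul_Gamma {c : ℂ} (hc : 0 < c.re) (z : ℂ) :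
    ∑' n : ℕ, (2 * z) ^ (2 * n) / ((2 * n).factorial : ℂ) *
      Complex.Gamma ((c + (2 * n : ℕ)) / 2) =
    Complex.Gamma (c / 2) * confluentHypergeometric (c / 2) (1 / 2) (z ^ 2) := by
  rw [confluentHypergeometric, ← tsum_mul_left]
  refine tsum_congr fun n => ?_
  have hp := ascPochhammer_eval_ne_zero one_half_add_nat_ne_zero n
  have hf : (n.factorial : ℂ) ≠ 0 := by exact_mod_cast n.factorial_ne_zero
  rw [cast_factorial_two_mul, pow_mul, show (c + (2 * n : ℕ)) / 2 = c / 2 + n by push_cast; ring,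
    Complex.Gamma_add_natCast_of_re_pos (by simpa using hc), mul_pow, mul_pow]
  norm_num only
  field_simp

theorem tsum_pow_two_mul_add_one_div_factorial_mul_Gamma {c : ℂ} (hc : 0 < c.re) (z : ℂ) :
    ∑' n : ℕ, (2 * z) ^ (2 * n + 1) / ((2 * n + 1).factorial : ℂ) *
      Complex.Gamma ((c + (2 * n + 1 : ℕ)) / 2) =
    2 * z * Complex.Gamma ((1 + c) / 2) *
      confluentHypergeometric ((1 + c) / 2) (3 / 2) (z ^ 2) := by
  rw [confluentHypergeometric, ← tsum_mul_left]
  refine tsum_congr fun n => ?_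
  have hw : 0 < ((1 + c) / 2).re := by
    simp only [Complex.div_ofNat_re, Complex.add_re, Complex.one_re]; linarith
  have hf : (n.factorial : ℂ) ≠ 0 := by exact_mod_cast n.factorial_ne_zero
  have hp : (ascPochhammer ℂ n).eval (3 / 2 : ℂ) ≠ 0 := fun h0 => by
    have := cast_factorial_two_mul_add_one n
    rw [h0, mul_zero] at this
    exact (2 * n + 1).factorial_ne_zero (by exact_mod_cast this)
  rw [cast_factorial_two_mul_add_one, pow_succ, pow_mul,
    show (c + (2 * n + 1 : ℕ)) / 2 = (1 + c) / 2 + n by push_cast; ring,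
    Complex.Gamma_add_natCast_of_re_pos hw, mul_pow, mul_pow]
  norm_num only
  field_simp

theorem tsum_even_add_odd_of_summable {f : ℕ → ℂ} (hf : Summable f) :
    ∑' n, f n = ∑' n, f (2 * n) + ∑' n, f (2 * n + 1) :=
  (tsum_even_add_odd (f := f) (hf.comp_injective fun m n h => by simpa using h)
    (hf.comp_injective fun m n h => by simpa using h)).symm

theorem integral_cpow_mul_exp_neg_sq_sub_mul {c : ℂ} (hc : 0 < c.re) (z : ℝ) :
    ∫ t : ℝ in Set.Ioi 0, (t : ℂ) ^ (c - 1) * Complex.exp (-(t : ℂ) ^ 2 + (2 * -z : ℝ) * t) =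
    Complex.Gamma (c / 2) / 2 * confluentHypergeometric (c / 2) (1 / 2) (z ^ 2) -
      z * Complex.Gamma ((1 + c) / 2) *
        confluentHypergeometric ((1 + c) / 2) (3 / 2) (z ^ 2) := by
  have h1 := tsum_pow_two_mul_div_factorial_mul_Gamma hc (-z)
  have h2 := tsum_pow_two_mul_add_one_div_factorial_mul_Gamma hc (-z)
  rw [neg_sq] at h1 h2
  rw [← (hasSum_integral_cpow_mul_exp_neg_sq_add_mul hc (2 * -z)).tsum_eq,
    tsum_even_add_odd_of_summable
      (hasSum_integral_cpow_mul_exp_neg_sq_add_mul hc (2 * -z)).summable]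
  simp only [← mul_div_assoc, tsum_div_const, Complex.ofReal_mul, Complex.ofReal_ofNat,
    Complex.ofReal_neg, h1, h2]
  ring

theorem Complex.Gamma_one_half_eq_sqrt_pi :
    Complex.Gamma (1 / 2) = (Real.sqrt Real.pi : ℝ) := by
  rw [Complex.Gamma_one_half_eq, Real.sqrt_eq_rpow, Complex.ofReal_cpow Real.pi_pos.le]
  norm_num

/-- The even and odd powers of `z` in the expanded integral give the two Kummer functions;
duplication at `-τ/2` matches the constants. -/
theorem Gamma_neg_mul_hermiteFunction {τ : ℂ} (hτ : τ.re < 0) (z : ℝ) :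
    Complex.Gamma (-τ) * hermiteFunction τ z = ∫ t : ℝ in Set.Ioi 0,
      (t : ℂ) ^ (-τ - 1) * Complex.exp (-(t : ℂ) ^ 2 + (2 * -z : ℝ) * t) := by
  have hw : 0 < (-τ / 2).re := by simpa using hτ
  have hw' : 0 < ((1 - τ) / 2).re := by
    simp only [Complex.div_ofNat_re, Complex.sub_re, Complex.one_re]; linarith
  rw [integral_cpow_mul_exp_neg_sq_sub_mul (by simpa using hτ), ← sub_eq_add_neg,
    hermiteFunction_eq, Complex.Gamma_one_half_eq_sqrt_pi]
  have hL := Complex.Gamma_mul_Gamma_add_half (-τ / 2)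
  have h1 := Complex.Gamma_ne_zero_of_re_pos hw
  have h2 := Complex.Gamma_ne_zero_of_re_pos hw'
  rw [show -τ / 2 + 1 / 2 = (1 - τ) / 2 by ring, show 2 * (-τ / 2) = -τ by ring,
    show 1 - -τ = τ + 1 by ring, Complex.cpow_add _ _ two_ne_zero, Complex.cpow_one] at hL
  have k1 : Complex.Gamma (-τ) * (2 ^ τ * (Real.sqrt Real.pi : ℝ)) *
      (Complex.Gamma ((1 - τ) / 2))⁻¹ = Complex.Gamma (-τ / 2) / 2 := by
    rw [mul_inv_eq_iff_eq_mul₀ h2]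
    linear_combination -(1 / 2) * hL
  have k2 : Complex.Gamma (-τ) * (2 ^ τ * (Real.sqrt Real.pi : ℝ)) *
      (Complex.Gamma (-τ / 2))⁻¹ = Complex.Gamma ((1 - τ) / 2) / 2 := by
    rw [mul_inv_eq_iff_eq_mul₀ h1]
    linear_combination -(1 / 2) * hL
  generalize confluentHypergeometric (-τ / 2) (1 / 2) (z ^ 2) = X
  generalize confluentHypergeometric ((1 - τ) / 2) (3 / 2) (z ^ 2) = Y
  linear_combination X * k1 - 2 * z * Y * k2

/-! ### Mellin transform for `Re τ < 0` by Fubini -/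

theorem integrable_indicator_cpow_mul_exp_neg_sq {s : ℂ} (hs : 0 < s.re) :
    Integrable fun x : ℝ => (Set.Ioi 0).indicator (fun x : ℝ => (x : ℂ) ^ (s - 1)) x *
      Complex.exp (-(x : ℂ) ^ 2) := by
  have h := (integrable_indicator_iff measurableSet_Ioi).2 (hasMellin_exp_neg_sq hs).1
  refine h.congr (.of_forall fun x => ?_)
  by_cases hx : x ∈ Set.Ioi (0 : ℝ) <;> simp [hx]

theorem integrable_indicator_cpow_mul_cpow_mul_exp_neg_add_sq {c s : ℂ} (hc : 0 < c.re)
    (hs : 0 < s.re) :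
    Integrable fun q : ℝ × ℝ => (Set.Ioi 0).indicator (fun x : ℝ => (x : ℂ) ^ (c - 1)) q.1 *
      (Set.Ioi 0).indicator (fun x : ℝ => (x : ℂ) ^ (s - 1)) q.2 *
        Complex.exp (-((q.1 + q.2 : ℝ) : ℂ) ^ 2) := by
  have hm : ∀ c : ℂ, Measurable ((Set.Ioi 0).indicator fun x : ℝ => (x : ℂ) ^ (c - 1)) :=
    fun c => Measurable.indicator (by fun_prop) measurableSet_Ioi
  have h := (integrable_indicator_cpow_mul_exp_neg_sq hc).mul_prod
    (integrable_indicator_cpow_mul_exp_neg_sq hs)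
  refine h.mono (Measurable.aestronglyMeasurable ?_) (.of_forall fun q => ?_)
  · exact (((hm c).comp measurable_fst).mul ((hm s).comp measurable_snd)).mul (by fun_prop)
  · by_cases h1 : 0 < q.1
    · by_cases h2 : 0 < q.2
      · simp only [norm_mul, Complex.norm_exp]
        rw [mul_mul_mul_comm]
        rw [← Real.exp_add]
        -- On the open quadrant the cross term of the square is positive, so a product of
        -- one-variable integrands dominates.
        refine mul_le_mul_of_nonneg_left (Real.exp_le_exp.2 ?_) (by positivity)
        norm_cast
        nlinarith [mul_pos h1 h2]
      · simp [h2]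
    · simp [h1]

theorem integral_indicator_cpow_mul_indicator_cpow_sub (c s : ℂ) (u : ℝ) :
    ∫ t : ℝ, (Set.Ioi 0).indicator (fun x : ℝ => (x : ℂ) ^ (c - 1)) t *
      (Set.Ioi 0).indicator (fun x : ℝ => (x : ℂ) ^ (s - 1)) (u - t) =
    (Set.Ioi 0).indicator (fun x : ℝ => (x : ℂ) ^ (c + s - 1)) u * Complex.betaIntegral c s := by
  have e : (fun t : ℝ => (Set.Ioi 0).indicator (fun x : ℝ => (x : ℂ) ^ (c - 1)) t *
      (Set.Ioi 0).indicator (fun x : ℝ => (x : ℂ) ^ (s - 1)) (u - t)) =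
      (Set.Ioo 0 u).indicator fun t : ℝ => (t : ℂ) ^ (c - 1) * ((u : ℂ) - t) ^ (s - 1) := by
    funext t
    by_cases h1 : 0 < t <;> by_cases h2 : t < u <;> simp [h1, h2]
  rw [e, integral_indicator measurableSet_Ioo]
  by_cases hu : 0 < u
  · rw [Set.indicator_of_mem (Set.mem_Ioi.2 hu), ← Complex.betaIntegral_scaled c s hu,
      intervalIntegral.integral_of_le hu.le, integral_Ioc_eq_integral_Ioo]
  · simp [hu]

/-- The measure-preserving shear `(t, x) ↦ (t, t + x)` frees the Gaussian from `t`; what remains in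
`t` is a convolution of powers, a Beta integral. -/
theorem integral_integral_cpow_mul_cpow_mul_exp_neg_add_sq {c s : ℂ} (hc : 0 < c.re)
    (hs : 0 < s.re) :
    ∫ x : ℝ, ∫ t : ℝ, (Set.Ioi 0).indicator (fun x : ℝ => (x : ℂ) ^ (c - 1)) t *
      (Set.Ioi 0).indicator (fun x : ℝ => (x : ℂ) ^ (s - 1)) x *
        Complex.exp (-((t + x : ℝ) : ℂ) ^ 2) =
    Complex.betaIntegral c s * (Complex.Gamma ((c + s) / 2) / 2) := by
  have hG := integrable_indicator_cpow_mul_cpow_mul_exp_neg_add_sq hc hs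
  set F : ℝ × ℝ → ℂ := fun q => (Set.Ioi 0).indicator (fun x : ℝ => (x : ℂ) ^ (c - 1)) q.1 *
      (Set.Ioi 0).indicator (fun x : ℝ => (x : ℂ) ^ (s - 1)) (q.2 - q.1) *
        Complex.exp (-(q.2 : ℂ) ^ 2) with hFdef
  have hp := measurePreserving_prod_add (volume : Measure ℝ) (volume : Measure ℝ)
  have he : MeasurableEmbedding fun z : ℝ × ℝ => (z.1, z.1 + z.2) :=
    (MeasurableEquiv.shearAddRight ℝ).measurableEmbedding
  have hFG : F ∘ (fun z : ℝ × ℝ => (z.1, z.1 + z.2)) = fun q : ℝ × ℝ =>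
      (Set.Ioi 0).indicator (fun x : ℝ => (x : ℂ) ^ (c - 1)) q.1 *
      (Set.Ioi 0).indicator (fun x : ℝ => (x : ℂ) ^ (s - 1)) q.2 *
        Complex.exp (-((q.1 + q.2 : ℝ) : ℂ) ^ 2) := by
    funext q
    simp [hFdef]
  have hF : Integrable F (volume.prod volume) := by
    rw [← hp.integrable_comp_emb he, hFG]
    exact hG
  rw [← integral_prod_symm _ hG, ← hFG]
  refine (hp.integral_comp he F).trans ?_
  rw [integral_prod_symm _ hF]
  simp only [hFdef, integral_mul_const, integral_indicator_cpow_mul_indicator_cpow_sub]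
  rw [← (hasMellin_exp_neg_sq (s := c + s) (by simp; positivity)).2, mellin,
    ← integral_indicator measurableSet_Ioi, ← integral_const_mul]
  refine integral_congr_ae (.of_forall fun x => ?_)
  by_cases hx : 0 < x
  · simp [hx]; ring
  · simp [hx]

theorem integral_indicator_cpow_mul_exp_neg_add_sq_eq_hermiteFunction {τ : ℂ} (hτ : τ.re < 0)
    (s : ℂ) (x : ℝ) :
    ∫ t : ℝ, (Set.Ioi 0).indicator (fun x : ℝ => (x : ℂ) ^ (-τ - 1)) t *
      (Set.Ioi 0).indicator (fun x : ℝ => (x : ℂ) ^ (s - 1)) x *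
        Complex.exp (-((t + x : ℝ) : ℂ) ^ 2) =
    (Set.Ioi 0).indicator (fun x : ℝ => Complex.Gamma (-τ) *
      ((x : ℂ) ^ (s - 1) • (Complex.exp (-(x : ℂ) ^ 2) * hermiteFunction τ x))) x := by
  by_cases hx : x ∈ Set.Ioi (0 : ℝ)
  · rw [Set.indicator_of_mem hx, Set.indicator_of_mem hx, smul_eq_mul, mul_left_comm,
      mul_left_comm (Complex.Gamma (-τ)), Gamma_neg_mul_hermiteFunction hτ,
      ← integral_indicator measurableSet_Ioi, ← integral_const_mul, ← integral_const_mul]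
    refine integral_congr_ae (.of_forall fun t => ?_)
    by_cases ht : t ∈ Set.Ioi (0 : ℝ)
    · simp only [Set.indicator_of_mem ht]
      have : Complex.exp (-((t + x : ℝ) : ℂ) ^ 2) = Complex.exp (-(x : ℂ) ^ 2) *
          Complex.exp (-(t : ℂ) ^ 2 + (2 * -x : ℝ) * t) := by
        rw [← Complex.exp_add]
        push_cast
        ring_nf
      rw [this]
      ring
    · simp [ht]
  · simp [hx]

theorem hasMellin_hermiteFunction_of_re_neg {τ s : ℂ} (hτ : τ.re < 0) (hs : 0 < s.re) :
    HasMellin (fun x : ℝ => Complex.exp (-(x : ℂ) ^ 2) * hermiteFunction τ x) s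
      ((Real.sqrt Real.pi : ℝ) * 2 ^ (τ - s) * Complex.Gamma s *
        (Complex.Gamma ((s - τ + 1) / 2))⁻¹) := by
  have hc : 0 < (-τ).re := by simpa using hτ
  have hΓ := Complex.Gamma_ne_zero_of_re_pos hc
  have hG := (integrable_indicator_cpow_mul_cpow_mul_exp_neg_add_sq hc hs).integral_prod_right
  have hI := integral_integral_cpow_mul_cpow_mul_exp_neg_add_sq hc hs
  simp only [integral_indicator_cpow_mul_exp_neg_add_sq_eq_hermiteFunction hτ] at hG hI
  rw [integral_indicator measurableSet_Ioi, integral_const_mul] at hI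
  rw [integrable_indicator_iff measurableSet_Ioi] at hG
  refine ⟨(IntegrableOn.congr_fun (hG.const_mul (Complex.Gamma (-τ))⁻¹)
    (fun x _ => inv_mul_cancel_left₀ hΓ _) measurableSet_Ioi), mul_left_cancel₀ hΓ (hI.trans ?_)⟩
  have hq : 0 < (-τ + s).re := by simp only [Complex.add_re]; linarith
  have hq' : 0 < ((s - τ + 1) / 2).re := by
    simp only [Complex.div_ofNat_re, Complex.add_re, Complex.sub_re, Complex.one_re]
    simp only [Complex.neg_re] at hc
    linarith
  have hB := Complex.Gamma_mul_Gamma_eq_betaIntegral hc hs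
  have hL := Complex.Gamma_mul_Gamma_add_half ((-τ + s) / 2)
  rw [show (-τ + s) / 2 + 1 / 2 = (s - τ + 1) / 2 by ring, show 2 * ((-τ + s) / 2) = -τ + s by ring,
    show 1 - (-τ + s) = τ - s + 1 by ring, Complex.cpow_add _ _ two_ne_zero, Complex.cpow_one] at hL
  have h1 := Complex.Gamma_ne_zero_of_re_pos hq
  have h2 := Complex.Gamma_ne_zero_of_re_pos hq'
  rw [← mul_assoc, eq_mul_inv_iff_mul_eq₀ h2]
  linear_combination (Complex.betaIntegral (-τ) s) / 2 * hL -
    (Real.sqrt Real.pi : ℝ) * 2 ^ (τ - s) * hB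

/-! ### Extension to every degree -/

theorem hasMellin_hermiteFunction_add_one {τ : ℂ}
    (h₀ : ∀ s : ℂ, 0 < s.re →
      HasMellin (fun x : ℝ => Complex.exp (-(x : ℂ) ^ 2) * hermiteFunction τ x) s
      ((Real.sqrt Real.pi : ℝ) * 2 ^ (τ - s) * Complex.Gamma s *
        (Complex.Gamma ((s - τ + 1) / 2))⁻¹))
    (h₁ : ∀ s : ℂ, 0 < s.re →
      HasMellin (fun x : ℝ => Complex.exp (-(x : ℂ) ^ 2) * hermiteFunction (τ - 1) x) s
      ((Real.sqrt Real.pi : ℝ) * 2 ^ (τ - 1 - s) * Complex.Gamma s *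
        (Complex.Gamma ((s - (τ - 1) + 1) / 2))⁻¹)) (s : ℂ) (hs : 0 < s.re) :
    HasMellin (fun x : ℝ => Complex.exp (-(x : ℂ) ^ 2) * hermiteFunction (τ + 1) x) s
      ((Real.sqrt Real.pi : ℝ) * 2 ^ (τ + 1 - s) * Complex.Gamma s *
        (Complex.Gamma ((s - (τ + 1) + 1) / 2))⁻¹) := by
  have hs0 : s ≠ 0 := by rintro rfl; simp at hs
  -- The factor `x` in the recurrence shifts the Mellin variable to `s + 1`.
  obtain ⟨c0, m0⟩ := h₀ (s + 1) (by simp; linarith)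
  obtain ⟨c1, m1⟩ := h₁ s hs
  rw [← MellinConvergent.cpow_smul] at c0
  rw [← mellin_cpow_smul] at m0
  obtain ⟨d0, n0⟩ := hasMellin_const_smul c0 (2 : ℂ)
  obtain ⟨d1, n1⟩ := hasMellin_const_smul c1 (2 * τ)
  have h := hasMellin_sub d0 d1
  rw [n0, n1, m0, m1] at h
  convert h using 1
  · funext x
    simp only [Complex.cpow_one, smul_eq_mul, hermiteFunction_add_one]
    ring
  · have g := Complex.one_div_Gamma_eq_self_mul_one_div_Gamma_add_one ((s - τ) / 2)
    rw [show (s - (τ + 1) + 1) / 2 = (s - τ) / 2 by ring, g,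
      show (s - (τ - 1) + 1) / 2 = (s - τ) / 2 + 1 by ring,
      show (s + 1 - τ + 1) / 2 = (s - τ) / 2 + 1 by ring, Complex.Gamma_add_one s hs0,
      show τ + 1 - s = τ - s - 1 + 1 + 1 by ring, show τ - (s + 1) = τ - s - 1 by ring,
      show τ - 1 - s = τ - s - 1 by ring, Complex.cpow_add _ _ two_ne_zero,
      Complex.cpow_add _ _ two_ne_zero, Complex.cpow_one, smul_eq_mul, smul_eq_mul]
    ring

theorem hasMellin_hermiteFunction (τ : ℂ) {s : ℂ} (hs : 0 < s.re) :
    HasMellin (fun x : ℝ => Complex.exp (-(x : ℂ) ^ 2) * hermiteFunction τ x) s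
      ((Real.sqrt Real.pi : ℝ) * 2 ^ (τ - s) * Complex.Gamma s *
        (Complex.Gamma ((s - τ + 1) / 2))⁻¹) := by
  obtain ⟨n, hn⟩ := exists_nat_gt τ.re
  -- Induction on a natural bound for `Re τ`: both `τ - 1` and `τ - 2` satisfy the previous bound.
  induction n using Nat.strong_induction_on generalizing τ s with
  | _ n ih =>
    rcases n with _ | n
    · exact hasMellin_hermiteFunction_of_re_neg (by simpa using hn) hs
    · have hlt : τ.re - 1 < n := by push_cast at hn; linarith
      have h := hasMellin_hermiteFunction_add_one (τ := τ - 1)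
        (fun s hs => ih n n.lt_succ_self (τ - 1) hs (by simpa using hlt))
        (fun s hs => ih n n.lt_succ_self (τ - 1 - 1) hs (by
          simp only [Complex.sub_re, Complex.one_re]; linarith)) s hs
      rwa [sub_add_cancel] at h

/-! ### Parity, moments and the conclusion -/

theorem integrable_of_integrableOn_Ioi_of_comp_neg {f : ℝ → ℂ} {c : ℂ}
    (hf : IntegrableOn f (Set.Ioi 0)) (hneg : ∀ x, f (-x) = c * f x) : Integrable f := by
  rw [← integrableOn_univ, ← Set.Iic_union_Ioi (a := (0 : ℝ)), integrableOn_union]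
  refine ⟨?_, hf⟩
  rw [integrableOn_Iic_iff_integrableOn_Iio,
    ← (Measure.measurePreserving_neg (volume : Measure ℝ)).integrableOn_comp_preimage
      (Homeomorph.neg ℝ).measurableEmbedding]
  simp only [Function.comp_def, Set.neg_preimage, Set.neg_Iio, neg_zero, hneg]
  exact hf.const_mul c

/-- Used with `c = (-1)ⁿ`, so that the factor is `2` or `0`. -/
theorem integral_eq_add_one_mul_integral_Ioi {f : ℝ → ℂ} {c : ℂ}
    (hf : IntegrableOn f (Set.Ioi 0)) (hneg : ∀ x, f (-x) = c * f x) :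
    ∫ x, f x = (c + 1) * ∫ x in Set.Ioi 0, f x := by
  have hi := integrable_of_integrableOn_Ioi_of_comp_neg hf hneg
  rw [← intervalIntegral.integral_Iic_add_Ioi hi.integrableOn hi.integrableOn (b := 0)]
  have h := integral_comp_neg_Ioi 0 f
  rw [neg_zero] at h
  rw [← h]
  simp only [hneg, integral_const_mul]
  ring

/-- The function `x ↦ xⁿ |x|^τ H_τ(|x|) e^{-x²}` on `ℝ`. -/
noncomputable def hermiteMomentIntegrand (τ : ℂ) (n : ℕ) (x : ℝ) : ℂ :=
  (x : ℂ) ^ n * ((|x| : ℝ) : ℂ) ^ τ * hermiteFunction τ ((|x| : ℝ) : ℂ) *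
    Complex.exp (-(x : ℂ) ^ 2)

theorem hermiteMomentIntegrand_neg (τ : ℂ) (n : ℕ) (x : ℝ) :
    hermiteMomentIntegrand τ n (-x) = (-1) ^ n * hermiteMomentIntegrand τ n x := by
  simp only [hermiteMomentIntegrand, abs_neg, Complex.ofReal_neg, neg_sq]
  rw [neg_pow (x : ℂ)]
  ring

theorem hermiteMomentIntegrand_of_pos (τ : ℂ) (n : ℕ) {x : ℝ} (hx : 0 < x) :
    hermiteMomentIntegrand τ n x = (x : ℂ) ^ (τ + n + 1 - 1) •
      (Complex.exp (-(x : ℂ) ^ 2) * hermiteFunction τ x) := by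
  rw [hermiteMomentIntegrand, abs_of_pos hx, add_sub_cancel_right,
    Complex.cpow_add _ _ (by exact_mod_cast hx.ne'), Complex.cpow_natCast, smul_eq_mul]
  ring

theorem integrableOn_hermiteMomentIntegrand {τ : ℂ} (hτ : -1 < τ.re) (n : ℕ) :
    IntegrableOn (hermiteMomentIntegrand τ n) (Set.Ioi 0) := by
  have hs : 0 < (τ + n + 1).re := by
    simp only [Complex.add_re, Complex.natCast_re, Complex.one_re]
    have : (0 : ℝ) ≤ n := n.cast_nonneg
    linarith
  exact (hasMellin_hermiteFunction τ hs).1.congr_fun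
    (fun x hx => (hermiteMomentIntegrand_of_pos τ n hx).symm) measurableSet_Ioi

theorem integrable_hermiteMomentIntegrand {τ : ℂ} (hτ : -1 < τ.re) (n : ℕ) :
    Integrable (hermiteMomentIntegrand τ n) :=
  integrable_of_integrableOn_Ioi_of_comp_neg (integrableOn_hermiteMomentIntegrand hτ n)
    (hermiteMomentIntegrand_neg τ n)

theorem integral_Ioi_hermiteMomentIntegrand_even {τ : ℂ} (hτ : -1 < τ.re) (k : ℕ) :
    ∫ x in Set.Ioi 0, hermiteMomentIntegrand τ (2 * k) x =
      (Real.sqrt Real.pi : ℝ) * Complex.Gamma (τ + 1) *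
        generalizedHermiteMoment τ (2 * k) / 2 := by
  have hτ' : 0 < (τ + 1).re := by
    simp only [Complex.add_re, Complex.one_re]
    linarith
  have hs : 0 < (τ + (2 * k : ℕ) + 1).re := by
    simp only [Complex.add_re, Complex.natCast_re, Complex.one_re]
    have : (0 : ℝ) ≤ (2 * k : ℕ) := Nat.cast_nonneg _
    linarith
  rw [setIntegral_congr_fun measurableSet_Ioi
    fun x hx => hermiteMomentIntegrand_of_pos τ (2 * k) hx]
  refine (hasMellin_hermiteFunction τ hs).2.trans ?_
  rw [generalizedHermiteMoment_even, add_right_comm, Complex.Gamma_add_natCast_of_re_pos hτ',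
    show (τ + 1 + (2 * k : ℕ) - τ + 1) / 2 = (k : ℂ) + 1 by push_cast; ring,
    Complex.Gamma_nat_eq_factorial,
    show τ - (τ + 1 + (2 * k : ℕ)) = -((2 * k + 1 : ℕ) : ℂ) by push_cast; ring,
    Complex.cpow_neg, Complex.cpow_natCast, pow_succ]
  have hf : (k.factorial : ℂ) ≠ 0 := by exact_mod_cast k.factorial_ne_zero
  field_simp

theorem integral_hermiteMomentIntegrand {τ : ℂ} (hτ : -1 < τ.re) (n : ℕ) :
    ∫ x, hermiteMomentIntegrand τ n x =
      (Real.sqrt Real.pi : ℝ) * Complex.Gamma (τ + 1) * generalizedHermiteMoment τ n := by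
  rw [integral_eq_add_one_mul_integral_Ioi (integrableOn_hermiteMomentIntegrand hτ n)
    (hermiteMomentIntegrand_neg τ n)]
  obtain ⟨k, rfl | rfl⟩ := n.even_or_odd'
  · rw [integral_Ioi_hermiteMomentIntegrand_even hτ, pow_mul]
    norm_num
    ring
  · rw [generalizedHermiteMoment_odd, pow_succ, pow_mul]
    norm_num

theorem mainTheorem1 (τ : ℂ) (hτ : -1 < τ.re) (p : Polynomial ℂ) :
    Integrable (fun x : ℝ => p.eval (x : ℂ) * ((|x| : ℝ) : ℂ) ^ τ *
      hermiteFunction τ ((|x| : ℝ) : ℂ) * Complex.exp (-(x : ℂ) ^ 2)) volume ∧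
    generalizedHermiteFunctional τ p =
      1 / (((Real.sqrt Real.pi : ℝ) : ℂ) * Complex.Gamma (τ + 1)) *
        ∫ x : ℝ, p.eval (x : ℂ) * ((|x| : ℝ) : ℂ) ^ τ *
          hermiteFunction τ ((|x| : ℝ) : ℂ) * Complex.exp (-(x : ℂ) ^ 2) := by
  have hΓ : Complex.Gamma (τ + 1) ≠ 0 := Complex.Gamma_ne_zero_of_re_pos (by
    simp only [Complex.add_re, Complex.one_re]
    linarith)
  have hπ : ((Real.sqrt Real.pi : ℝ) : ℂ) ≠ 0 := by
    exact_mod_cast (Real.sqrt_pos.2 Real.pi_pos).ne'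
  have hsum : (fun x : ℝ => p.eval (x : ℂ) * ((|x| : ℝ) : ℂ) ^ τ *
      hermiteFunction τ ((|x| : ℝ) : ℂ) * Complex.exp (-(x : ℂ) ^ 2)) =
      fun x : ℝ => ∑ n ∈ p.support, p.coeff n * hermiteMomentIntegrand τ n x := by
    funext x
    simp only [Polynomial.eval_eq_sum, Polynomial.sum, Finset.sum_mul, hermiteMomentIntegrand,
      mul_assoc]
  have hint : ∀ n ∈ p.support, Integrable fun x : ℝ =>
      p.coeff n * hermiteMomentIntegrand τ n x :=
    fun n _ => (integrable_hermiteMomentIntegrand hτ n).const_mul _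
  rw [hsum]
  refine ⟨integrable_finsetSum _ hint, ?_⟩
  rw [integral_finsetSum _ hint, Finset.mul_sum]
  conv_lhs => rw [p.as_sum_support_C_mul_X_pow, map_sum]
  refine Finset.sum_congr rfl fun n _ => ?_
  rw [← Polynomial.smul_eq_C_mul, map_smul, generalizedHermiteFunctional_X_pow,
    integral_const_mul, integral_hermiteMomentIntegrand hτ, smul_eq_mul]
  field_simp
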